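/- Let $\mathcal H$ be a finite-dimensional complex Hilbert space. A state on $\mathcal H$ is a positive semidefinite operator of trace $1$. For $\epsilon>0$, a state $\rho$ and a positive semidefinite operator $\sigma$, the hypothesis testing relative entropy $D_H^{\epsilon}(\rho\|\sigma)\in[-\infty,\infty]$ is defined by $$2^{-D_H^{\epsilon}(\rho\|\sigma)}=\frac1\epsilon\,\min\{\operatorname{Tr}(Q\sigma)\;:\;0\le Q\le \mathbb I,\ \operatorname{Tr}(Q\rho)\ge\epsilon\},$$ with $D_H^\epsilon=+\infty$ if the minimum is $0$, and $D_H^\epsilon=-\infty$ (the minimum over the empty set being $+\infty$) if no such $Q$ exists, that is, if $\epsilon>1$. All logarithms are to base $2$. **Proposition (decomposition of hypothesis tests).** Let $G$ be a finite group, let $g\mapsto U_g$ be a unitary representation of $G$ on $\mathcal H$, and let $\mathcal E_G(A)=\frac1{|G|}\sum_{g\in G}U_gAU_g^\dagger$. Let $\rho,\sigma$ be states on $\mathcal H$ with $\sigma=\mathcal E_G(\sigma)$, and let $\xi=\mathcal E_G(\rho)$. Then, for all $\epsilon,\epsilon'>0$, $$D_H^{\epsilon+\sqrt{2\epsilon'}}(\rho\|\sigma)\;\le\;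 D_H^{\epsilon}(\rho\|\xi)+D_H^{\epsilon'}(\xi\|\sigma)+\log\frac{\epsilon+\sqrt{2\epsilon'}}{\epsilon},$$ as an inequality in $[-\infty,\infty]$, where $(-\infty)+(+\infty)$ is read as $-\infty$ (this can occur only when $\epsilon>1$, and then the left-hand side is $-\infty$ as well). -/

import Mathlib

open scoped ENNReal ComplexOrder

/-- A (normalized) quantum state on `ℂⁿ`: a positive semidefinite operator with trace one. -/
structure IsQuantumState {n : Type*} [Fintype n] (ρ : Matrix n n ℂ) : Prop where
  posSemidef : ρ.PosSemidef
  trace_eq_one : ρ.trace = 1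

/-- The tests with success probability at least `ε` on `ρ`: the operators `Q` with `0 ≤ Q ≤ 1`
(operator inequalities) and `Tr(Q ρ) ≥ ε`. -/
def hypothesisTests {n : Type*} [Fintype n] [DecidableEq n] (ε : ℝ) (ρ : Matrix n n ℂ) :
    Set (Matrix n n ℂ) :=
  {Q | Q.PosSemidef ∧ (1 - Q).PosSemidef ∧ ε ≤ (Q * ρ).trace.re}

/-- `(1 / ε) * min {Tr(Q σ) | 0 ≤ Q ≤ 1, Tr(Q ρ) ≥ ε}` as an element of `[0, ∞]`; it is `∞`
when there is no such `Q`. -/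
noncomputable def optimalTestValue {n : Type*} [Fintype n] [DecidableEq n] (ε : ℝ)
    (ρ σ : Matrix n n ℂ) : ℝ≥0∞ :=
  (ENNReal.ofReal ε)⁻¹ * ⨅ Q ∈ hypothesisTests ε ρ, ENNReal.ofReal (Q * σ).trace.re

/-- The hypothesis testing relative entropy `D_H^ε(ρ‖σ) = - log₂ (optimalTestValue ε ρ σ)`, with
values in `[-∞, ∞]`, where `log₂ 0 = -∞` and `log₂ ∞ = ∞`. -/
noncomputable def hypothesisTestingRelEntropy {n : Type*} [Fintype n] [DecidableEq n] (ε : ℝ)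
    (ρ σ : Matrix n n ℂ) : EReal :=
  -((optimalTestValue ε ρ σ).log / ((Real.log 2 : ℝ) : EReal))

/-- The group twirl `A ↦ (1 / |G|) ∑_g U_g A U_g†` of a unitary representation of a finite
group. -/
noncomputable def groupTwirl {G n : Type*} [Group G] [Fintype G] [Fintype n] [DecidableEq n]
    (U : G →* Matrix.unitaryGroup n ℂ) (A : Matrix n n ℂ) : Matrix n n ℂ :=
  (Fintype.card G : ℂ)⁻¹ •
    ∑ g : G, (U g : Matrix n n ℂ) * A * (U g : Matrix n n ℂ).conjTranspose

/-! A test for `ρ` against `σ` is turned into one for `ρ` against `ξ` by conjugating it with a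
group-invariant contraction. Take `μ > 0` such that every test with success at least `ε'` on `ξ` has
`σ`-value above `μ ε'`. Then the positive part of `μ ξ - σ` has trace below `μ ε'`
(`re_trace_posPart_lt`), so `μ ξ ≤ σ + Y` for some invertible `Y ≥ 0` with `Tr Y ≤ μ ε'`. Put `T =
σ^{1/2} (σ + Y)^{-1/2}`. As `T (σ + Y) Tᴴ = σ`, the test `Tᴴ Q T` satisfies `μ Tr(Tᴴ Q T ξ) ≤ Tr(Q
σ)`.

Both `σ` and `ξ` commute with the representation, hence so does `T`, and `Tr(T ρ) = Tr(T ξ)`. The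
real part of this overlap is at least `1 - ε'`, so a gentle-measurement bound
(`re_trace_mul_le_of_contraction`) shows that `T` costs at most `√(2 ε')` of success probability on
`ρ`. Letting `μ` approach the optimal value and taking logarithms gives the claim. -/

namespace Matrix

open scoped MatrixOrder

variable {n : Type*} [Fintype n]

/-! ### Positive semidefinite matrices, contractions and gentle measurement -/

theorem PosSemidef.re_trace_nonneg {A : Matrix n n ℂ} (hA : A.PosSemidef) : 0 ≤ A.trace.re :=
  (Complex.le_def.mp hA.trace_nonneg).1

theorem PosSemidef.re_trace_mul_nonneg [DecidableEq n] {A B : Matrix n n ℂ} (hA : A.PosSemidef)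
    (hB : B.PosSemidef) : 0 ≤ (A * B).trace.re := by
  obtain ⟨C, rfl⟩ := CStarAlgebra.nonneg_iff_eq_star_mul_self.mp (nonneg_iff_posSemidef.mpr hB)
  rw [← mul_assoc, trace_mul_comm, ← mul_assoc]
  exact (hA.mul_mul_conjTranspose_same C).re_trace_nonneg

theorem re_trace_conjTranspose (A : Matrix n n ℂ) : Aᴴ.trace.re = A.trace.re := by
  simp [trace_conjTranspose]

variable [DecidableEq n]

theorem cfc_posSemidef {H : Matrix n n ℂ} {f : ℝ → ℝ} (hf : ∀ x, 0 ≤ f x) :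
    (cfc f H).PosSemidef :=
  nonneg_iff_posSemidef.mp (cfc_nonneg fun x _ => hf x)

/-- The commutation clause is what later makes the contraction group-invariant. -/
theorem PosSemidef.exists_sqrt {M : Matrix n n ℂ} (hM : M.PosSemidef) :
    ∃ A : Matrix n n ℂ, A.PosSemidef ∧ A * A = M ∧ ∀ V, Commute M V → Commute A V := by
  have h0 : 0 ≤ M := nonneg_iff_posSemidef.mpr hM
  have hs : IsSelfAdjoint M := hM.1
  refine ⟨cfc Real.sqrt M, cfc_posSemidef Real.sqrt_nonneg, ?_,
    fun V hV => hV.cfc_real _⟩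
  rw [← cfc_mul Real.sqrt Real.sqrt M]
  conv_rhs => rw [← cfc_id ℝ M]
  refine cfc_congr fun x hx => ?_
  exact Real.mul_self_sqrt (spectrum_nonneg_of_nonneg h0 hx)

/-- The positive part `X = P * H` of a Hermitian matrix, with the projection `P` onto the positive
eigenspaces. -/
theorem IsHermitian.exists_posPart {H : Matrix n n ℂ} (hH : H.IsHermitian) :
    ∃ P : Matrix n n ℂ, P.PosSemidef ∧ (1 - P).PosSemidef ∧ (P * H).PosSemidef ∧
      (P * H - H).PosSemidef ∧ ∀ V, Commute H V → Commute P V := by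
  have hs : IsSelfAdjoint H := hH
  have hc : ∀ f : ℝ → ℝ, ContinuousOn f (spectrum ℝ H) := fun f =>
    (Matrix.finite_real_spectrum (A := H)).continuousOn f
  let f : ℝ → ℝ := fun x => if 0 < x then 1 else 0
  have hPH : cfc f H * H = cfc (fun x => f x * x) H := by
    rw [cfc_mul f (fun x => x) H (hc _) (hc _), cfc_id' ℝ H]
  refine ⟨cfc f H, cfc_posSemidef fun x => ?_, ?_, ?_, ?_, fun V hV => hV.cfc_real _⟩
  · dsimp only [f]; split_ifs <;> norm_num
  · rw [← cfc_const_one ℝ H, ← cfc_sub _ _ H (hc _) (hc _)]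
    refine cfc_posSemidef fun x => ?_
    dsimp only [f]; split_ifs <;> norm_num
  · rw [hPH]
    refine cfc_posSemidef fun x => ?_
    dsimp only [f]
    split_ifs with h
    · simp [h.le]
    · simp
  · rw [hPH]
    nth_rewrite 2 [← cfc_id' ℝ H]
    rw [← cfc_sub _ _ H (hc _) (hc _)]
    refine cfc_posSemidef fun x => ?_
    dsimp only [f]
    split_ifs with h
    · simp
    · simp [not_lt.mp h]

/-- Operator monotonicity of the square root. -/
theorem PosSemidef.sub_of_mul_self_sub {A B : Matrix n n ℂ} (hA : A.PosSemidef) (hB : B.PosDef)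
    (h : (B * B - A * A).PosSemidef) : (B - A).PosSemidef := by
  have hD : (B - A).IsHermitian := hB.1.sub hA.1
  rw [hD.posSemidef_iff_eigenvalues_nonneg]
  intro i
  set v := (hD.eigenvectorBasis i).ofLp with hv
  set l := hD.eigenvalues i with hl
  have hv0 : v ≠ 0 := by
    intro h0
    have := hD.eigenvectorBasis.orthonormal.1 i
    have h1 : hD.eigenvectorBasis i = 0 := by ext j; exact congrFun h0 j
    simp [h1] at this
  have hDv : (B - A) *ᵥ v = (l : ℂ) • v := by
    have := hD.mulVec_eigenvectorBasis i
    rw [this]; ext; simp [hl, hv]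
  have hvD : star v ᵥ* (B - A) = (l : ℂ) • star v := by
    have := congrArg star hDv
    rw [star_mulVec, hD.eq] at this
    rw [this]; ext; simp
  have hS : (B + A).PosDef := hB.add_posSemidef hA
  have hpos := hS.dotProduct_mulVec_pos hv0
  have hnn := h.dotProduct_mulVec_nonneg v
  -- Symmetrising, `2 (B² - A²) = (B - A)(B + A) + (B + A)(B - A)`. On an eigenvector of `B - A`
  -- this yields the eigenvalue times the strictly positive form of `B + A`.
  have key : (2 : ℂ) * (star v ⬝ᵥ (B * B - A * A) *ᵥ v)
      = 2 * (l * (star v ⬝ᵥ (B + A) *ᵥ v)) := by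
    have e : (2 : ℂ) • (B * B - A * A) = (B - A) * (B + A) + (B + A) * (B - A) := by
      rw [two_smul]; noncomm_ring
    have e2 : (2 : ℂ) * (star v ⬝ᵥ (B * B - A * A) *ᵥ v)
        = star v ⬝ᵥ ((2 : ℂ) • (B * B - A * A)) *ᵥ v := by
      rw [smul_mulVec, dotProduct_smul, smul_eq_mul]
    rw [e2, e, add_mulVec, dotProduct_add, ← mulVec_mulVec, ← mulVec_mulVec, hDv, dotProduct_mulVec,
      hvD, mulVec_smul, dotProduct_smul, smul_dotProduct, smul_eq_mul]
    ring
  have key' := mul_left_cancel₀ two_ne_zero key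
  rw [key'] at hnn
  have a := (Complex.le_def.mp hnn).1
  have b := (Complex.lt_def.mp hpos).1
  rw [Complex.re_ofReal_mul] at a
  simp only [Complex.zero_re] at a b
  exact nonneg_of_mul_nonneg_left a b

/-- A contraction `T` with `T * (σ + Y) * Tᴴ = σ` and large overlap with `σ + Y`. -/
theorem PosSemidef.exists_contraction {σ Y : Matrix n n ℂ} (hσ : σ.PosSemidef) (hY : Y.PosDef) :
    ∃ T : Matrix n n ℂ, (1 - Tᴴ * T).PosSemidef ∧ T * (σ + Y) * Tᴴ = σ ∧
      σ.trace.re ≤ (T * (σ + Y)).trace.re ∧ ∀ V, Commute σ V → Commute Y V → Commute T V := by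
  have hS : (σ + Y).PosDef := hY.posSemidef_add hσ
  obtain ⟨A, hA, hAA, hAc⟩ := hσ.exists_sqrt
  obtain ⟨B, hB, hBB, hBc⟩ := hS.posSemidef.exists_sqrt
  have hBu : IsUnit B := isUnit_of_mul_isUnit_left (hBB ▸ hS.isUnit)
  have hBd : B.PosDef := hB.posDef_iff_isUnit.mpr hBu
  have hdet : IsUnit B.det := (isUnit_iff_isUnit_det B).mp hBu
  have h1 : B⁻¹ * B = 1 := nonsing_inv_mul _ hdet
  have h2 : B * B⁻¹ = 1 := mul_nonsing_inv _ hdet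
  have hT : (A * B⁻¹)ᴴ = B⁻¹ * A := by
    rw [conjTranspose_mul, hA.1.eq, conjTranspose_nonsing_inv, hB.1.eq]
  have hsub : (B * B - A * A).PosSemidef := by
    rw [hBB, hAA, add_sub_cancel_left]; exact hY.posSemidef
  -- With `A = σ^{1/2}` and `B = (σ + Y)^{1/2}`, contractivity is `A² ≤ B²`. The overlap is `Tr(A B)
  -- ≥ Tr(A²)`, because `A ≤ B` by operator monotonicity.
  refine ⟨A * B⁻¹, ?_, ?_, ?_, ?_⟩
  · have : 1 - (A * B⁻¹)ᴴ * (A * B⁻¹) = B⁻¹ * (B * B - A * A) * (B⁻¹)ᴴ := by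
      rw [hT, conjTranspose_nonsing_inv, hB.1.eq]
      have e : B⁻¹ * (B * B - A * A) * B⁻¹ = (B⁻¹ * B) * (B * B⁻¹) - B⁻¹ * A * (A * B⁻¹) := by
        noncomm_ring
      rw [e, h1, h2, one_mul]
    rw [this]
    exact hsub.mul_mul_conjTranspose_same _
  · have e : A * B⁻¹ * (B * B) * (B⁻¹ * A) = A * (B⁻¹ * B) * (B * B⁻¹) * A := by noncomm_ring
    rw [hT, ← hBB, e, h1, h2, mul_one, mul_one, hAA]
  · have e : A * B⁻¹ * (B * B) = A * (B⁻¹ * B) * B := by noncomm_ring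
    rw [← hBB, e, h1, mul_one, ← hAA]
    have := hA.re_trace_mul_nonneg (hA.sub_of_mul_self_sub hBd hsub)
    rw [mul_sub, trace_sub, Complex.sub_re] at this
    linarith
  · intro V hσV hYV
    refine (hAc V hσV).mul_left ?_
    have hBV := hBc V (hσV.add_left hYV)
    calc B⁻¹ * V = B⁻¹ * (V * B) * B⁻¹ := by rw [mul_assoc, mul_assoc, h2, mul_one]
      _ = B⁻¹ * (B * V) * B⁻¹ := by rw [hBV.eq]
      _ = V * B⁻¹ := by rw [← mul_assoc, h1, one_mul]

/-- Cauchy–Schwarz inequality for the form `(M, N) ↦ Re Tr(M ρ Nᴴ)`. -/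
theorem PosSemidef.sq_re_trace_le {ρ R : Matrix n n ℂ} (hρ : ρ.PosSemidef) (hR : R.IsHermitian)
    (hR1 : (1 - R * R).PosSemidef) (D S : Matrix n n ℂ) :
    (R * D * ρ * Sᴴ).trace.re ^ 2 ≤ (D * ρ * Dᴴ).trace.re * (S * ρ * Sᴴ).trace.re := by
  have hsymm : (S * ρ * Dᴴ * R).trace.re = (R * D * ρ * Sᴴ).trace.re := by
    rw [← re_trace_conjTranspose (R * D * ρ * Sᴴ)]
    simp only [conjTranspose_mul, conjTranspose_conjTranspose, hR.eq, hρ.1.eq, mul_assoc]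
  have hcontr : (R * D * ρ * Dᴴ * R).trace.re ≤ (D * ρ * Dᴴ).trace.re := by
    have := hR1.re_trace_mul_nonneg (hρ.mul_mul_conjTranspose_same D)
    rw [sub_mul, one_mul, trace_sub, Complex.sub_re, mul_assoc R R, trace_mul_comm R] at this
    simp only [mul_assoc] at this ⊢
    linarith
  -- Expand `Tr((tRD - S) ρ (tRD - S)ᴴ) ≥ 0` in `t`; since `R² ≤ 1`, the leading coefficient may be
  -- enlarged by dropping `R`. The discriminant gives the bound.
  have hq : ∀ t : ℝ, 0 ≤ (D * ρ * Dᴴ).trace.re * (t * t)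
      + (-2 * (R * D * ρ * Sᴴ).trace.re) * t + (S * ρ * Sᴴ).trace.re := by
    intro t
    have h := (hρ.mul_mul_conjTranspose_same ((t : ℂ) • (R * D) - S)).re_trace_nonneg
    have e : ((t : ℂ) • (R * D) - S) * ρ * ((t : ℂ) • (R * D) - S)ᴴ
        = ((t * t : ℝ) : ℂ) • (R * D * ρ * Dᴴ * R) - (t : ℂ) • (R * D * ρ * Sᴴ)
          - (t : ℂ) • (S * ρ * Dᴴ * R) + S * ρ * Sᴴ := by
      simp only [conjTranspose_sub, conjTranspose_smul, conjTranspose_mul, hR.eq, sub_mul, mul_sub,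
        smul_mul_assoc, mul_smul_comm, mul_assoc, Complex.star_def, Complex.conj_ofReal,
        Complex.ofReal_mul]
      module
    rw [e] at h
    simp only [trace_add, trace_sub, trace_smul, smul_eq_mul, Complex.add_re, Complex.sub_re,
      Complex.re_ofReal_mul, hsymm] at h
    nlinarith [mul_le_mul_of_nonneg_left hcontr (mul_self_nonneg t)]
  have := discrim_le_zero hq
  rw [discrim] at this
  nlinarith

/-- The matrix is `4 Q (1 - Q)`, and `Q (1 - Q) = Q (1 - Q) Q + (1 - Q) Q (1 - Q)` is a sum of
conjugations of positive matrices. This admits `R = 2Q - 1` in the Cauchy–Schwarz bound. -/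
theorem PosSemidef.one_sub_sq_posSemidef {Q : Matrix n n ℂ} (hQ : Q.PosSemidef)
    (hQ1 : (1 - Q).PosSemidef) :
    (1 - ((2 : ℂ) • Q - 1) * ((2 : ℂ) • Q - 1)).PosSemidef := by
  have h1 := hQ1.conjTranspose_mul_mul_same Q
  have h2 := hQ.conjTranspose_mul_mul_same (1 - Q)
  rw [hQ.1.eq] at h1
  rw [hQ1.1.eq] at h2
  have e : 1 - ((2 : ℂ) • Q - 1) * ((2 : ℂ) • Q - 1)
      = (4 : ℂ) • (Q * (1 - Q) * Q + (1 - Q) * Q * (1 - Q)) := by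
    simp only [two_smul, show (4 : ℂ) = 1 + 1 + 1 + 1 by norm_num, add_smul, one_smul]
    noncomm_ring
  rw [e]
  exact (h1.add h2).smul (by norm_num)

/-- A contraction with large overlap disturbs the success probability of a test only little. -/
theorem PosSemidef.re_trace_mul_le_of_contraction {ρ T Q : Matrix n n ℂ} {δ : ℝ}
    (hρ : ρ.PosSemidef) (htr : ρ.trace = 1) (hT : (1 - Tᴴ * T).PosSemidef)
    (hQ : Q.PosSemidef) (hQ1 : (1 - Q).PosSemidef) (hδ : 1 - δ ≤ (T * ρ).trace.re) :
    (Q * ρ).trace.re ≤ (Tᴴ * Q * T * ρ).trace.re + √(2 * δ) := by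
  set o := (T * ρ).trace.re with ho
  set f := (T * ρ * Tᴴ).trace.re with hf
  -- Polarisation: the product of `1 - T` and `1 + T` produces the difference of the success
  -- probabilities before and after `T`, up to the trace loss `1 - f`.
  set y := ((2 • Q - 1) * (1 - T) * ρ * (1 + T)ᴴ).trace.re with hy
  have ho' : (ρ * Tᴴ).trace.re = o := by
    rw [ho, ← re_trace_conjTranspose (T * ρ), conjTranspose_mul, hρ.1.eq]
  have hρ1 : ρ.trace.re = 1 := by rw [htr]; rfl
  have hf0 : 0 ≤ f := (hρ.mul_mul_conjTranspose_same T).re_trace_nonneg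
  have hf1 : f ≤ 1 := by
    have := hT.re_trace_mul_nonneg hρ
    rw [sub_mul, one_mul, trace_sub, Complex.sub_re, hρ1, mul_assoc, trace_mul_comm] at this
    linarith
  have hd : ((1 - T) * ρ * (1 - T)ᴴ).trace.re = 1 + f - 2 * o := by
    simp only [conjTranspose_sub, conjTranspose_one, sub_mul, mul_sub, one_mul, mul_one, trace_sub,
      Complex.sub_re, hρ1, ho', ← ho, ← hf]
    ring
  have hs : ((1 + T) * ρ * (1 + T)ᴴ).trace.re = 1 + f + 2 * o := by
    simp only [conjTranspose_add, conjTranspose_one, add_mul, mul_add, one_mul, mul_one, trace_add,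
      Complex.add_re, hρ1, ho', ← ho, ← hf]
    ring
  have hyv : y = 2 * ((Q * ρ).trace.re - (Tᴴ * Q * T * ρ).trace.re) - (1 - f) := by
    have e1 : (Q * ρ * Tᴴ).trace.re = (Q * T * ρ).trace.re := by
      rw [← re_trace_conjTranspose (Q * ρ * Tᴴ)]
      simp only [conjTranspose_mul, conjTranspose_conjTranspose, hQ.1.eq, hρ.1.eq]
      rw [← mul_assoc, trace_mul_comm, ← mul_assoc]
    have e2 : (Tᴴ * Q * T * ρ).trace = (Q * T * ρ * Tᴴ).trace := by
      rw [mul_assoc, mul_assoc, trace_mul_comm, mul_assoc, mul_assoc, mul_assoc, mul_assoc]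
    have e : (2 • Q - 1) * (1 - T) * ρ * (1 + T)ᴴ
        = 2 • (Q * ρ) + 2 • (Q * ρ * Tᴴ) - 2 • (Q * T * ρ) - 2 • (Q * T * ρ * Tᴴ)
          - ρ - ρ * Tᴴ + T * ρ + T * ρ * Tᴴ := by
      rw [conjTranspose_add, conjTranspose_one]
      noncomm_ring
    rw [hy, e, e2]
    simp only [two_nsmul, trace_add, trace_sub, Complex.add_re, Complex.sub_re, e1, ho', hρ1, ← ho,
      ← hf]
    ring
  have hyy : y ^ 2 ≤ (1 + f - 2 * o) * (1 + f + 2 * o) := by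
    have hR : ((2 : ℂ) • Q - 1).IsHermitian := by
      refine IsHermitian.sub ?_ isHermitian_one
      rw [two_smul]; exact hQ.1.add hQ.1
    have := hρ.sq_re_trace_le hR (hQ.one_sub_sq_posSemidef hQ1) (1 - T) (1 + T)
    rwa [hd, hs, two_smul, ← two_nsmul] at this
  -- The left side is the squared loss of success probability. Inserting `y² ≤ (1 + f)² - 4o²` and
  -- `y ≤ 1 + f` into its expansion makes `f` cancel.
  have hlam : ((y + (1 - f)) / 2) ^ 2 ≤ 1 - o ^ 2 := by
    have hy1 : y ≤ 1 + f := abs_le_of_sq_le_sq' (by nlinarith [sq_nonneg o]) (by linarith) |>.2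
    nlinarith [mul_nonneg (sub_nonneg.mpr hf1) (sub_nonneg.mpr hy1)]
  have hdel : 1 - o ^ 2 ≤ 2 * δ := by
    rcases le_total δ 1 with h | h <;> nlinarith [sq_nonneg o]
  have := Real.le_sqrt_of_sq_le (hlam.trans hdel)
  linarith

end Matrix

/-! ### Twirling over the group -/

section Twirl

variable {G n : Type*} [Group G] [Fintype G] [Fintype n] [DecidableEq n]
  (U : G →* Matrix.unitaryGroup n ℂ)

theorem groupTwirl_commute (A : Matrix n n ℂ) (h : G) :
    Commute (groupTwirl U A) (U h : Matrix n n ℂ) := by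
  have hU : ∀ g, ((U g : Matrix n n ℂ)).conjTranspose * (U g : Matrix n n ℂ) = 1 := fun g =>
    Matrix.UnitaryGroup.star_mul_self (U g)
  unfold groupTwirl
  refine Commute.smul_left ?_ _
  change (∑ g : G, _) * _ = _ * (∑ g : G, _)
  -- Reindexing by `g ↦ h g` turns the conjugate `U_{hg}†` times `U_h` into `U_g†`.
  rw [Finset.sum_mul, Finset.mul_sum, ← Equiv.sum_comp (Equiv.mulLeft h)
    fun g => (U g : Matrix n n ℂ) * A * (U g : Matrix n n ℂ).conjTranspose * (U h : Matrix n n ℂ)]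
  refine Finset.sum_congr rfl fun g _ => ?_
  simp only [Equiv.coe_mulLeft, map_mul, Matrix.UnitaryGroup.mul_val, Matrix.conjTranspose_mul]
  simp only [mul_assoc, hU, mul_one]

theorem groupTwirl_posSemidef {A : Matrix n n ℂ} (hA : A.PosSemidef) :
    (groupTwirl U A).PosSemidef :=
  (Matrix.posSemidef_sum _ fun _ _ => hA.mul_mul_conjTranspose_same _).smul
    (inv_nonneg.mpr (Nat.cast_nonneg _))

/-- By cyclicity of the trace, an invariant operator cannot distinguish `A` from its twirl; this
transfers the overlap from `ξ` to `ρ`. -/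
theorem trace_mul_groupTwirl {T : Matrix n n ℂ} (A : Matrix n n ℂ)
    (hT : ∀ g, Commute T (U g : Matrix n n ℂ)) :
    (T * groupTwirl U A).trace = (T * A).trace := by
  have hU : ∀ g, ((U g : Matrix n n ℂ)).conjTranspose * (U g : Matrix n n ℂ) = 1 := fun g =>
    Matrix.UnitaryGroup.star_mul_self (U g)
  have h : ∀ g, (T * ((U g : Matrix n n ℂ) * A * (U g : Matrix n n ℂ).conjTranspose)).trace
      = (T * A).trace := fun g => by
    rw [← mul_assoc, ← mul_assoc, (hT g).eq, Matrix.trace_mul_comm, ← mul_assoc, ← mul_assoc, hU,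
      one_mul]
  have hG : (Fintype.card G : ℂ) ≠ 0 := by exact_mod_cast Fintype.card_ne_zero
  simp only [groupTwirl, mul_smul_comm, Finset.mul_sum, Matrix.trace_smul, Matrix.trace_sum, h,
    Finset.sum_const, Finset.card_univ, nsmul_eq_mul, smul_eq_mul]
  rw [inv_mul_cancel_left₀ hG]

theorem trace_groupTwirl (A : Matrix n n ℂ) : (groupTwirl U A).trace = A.trace := by
  simpa using trace_mul_groupTwirl U A (T := 1) fun _ => Commute.one_left _

end Twirl

/-! ### Transforming tests and comparing optimal values -/

section Decomposition

open Matrix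

variable {n G : Type*} [Fintype n] [DecidableEq n]

/-- With `p = Tr(P ξ)`, the trace is `μ p - Tr(P σ)`, so `p < ε'` suffices. If `p ≥ ε'`, the
rescaled test `(ε' / p) P` has success exactly `ε'`, whence `Tr(P σ) > μ p`, contradicting
positivity. -/
theorem re_trace_posPart_lt {ξ σ P : Matrix n n ℂ} {μ ε' : ℝ} (hσ : σ.PosSemidef)
    (hμ : 0 < μ) (hε' : 0 < ε') (hP : P.PosSemidef) (hP1 : (1 - P).PosSemidef)
    (hPH : (P * ((μ : ℂ) • ξ - σ)).PosSemidef)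
    (hβ : ∀ Q ∈ hypothesisTests ε' ξ, μ * ε' < (Q * σ).trace.re) :
    (P * ((μ : ℂ) • ξ - σ)).trace.re < μ * ε' := by
  have h0 := hPH.re_trace_nonneg
  have e : (P * ((μ : ℂ) • ξ - σ)).trace.re = μ * (P * ξ).trace.re - (P * σ).trace.re := by
    rw [mul_sub, mul_smul_comm, trace_sub, trace_smul, Complex.sub_re, smul_eq_mul,
      Complex.re_ofReal_mul]
  have hPσ := hP.re_trace_mul_nonneg hσ
  rw [e] at h0 ⊢
  set p := (P * ξ).trace.re with hp
  rcases lt_or_ge p ε' with h | h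
  · linarith [mul_lt_mul_of_pos_left h hμ]
  · exfalso
    have hp0 : 0 < p := hε'.trans_le h
    have hc0 : 0 ≤ ε' / p := by positivity
    have hc1 : 0 ≤ 1 - ε' / p := sub_nonneg.mpr ((div_le_one hp0).mpr h)
    have hmem : ((ε' / p : ℝ) : ℂ) • P ∈ hypothesisTests ε' ξ := by
      refine ⟨hP.smul (by exact_mod_cast hc0), ?_, ?_⟩
      · have : 1 - ((ε' / p : ℝ) : ℂ) • P = (1 - P) + ((1 - ε' / p : ℝ) : ℂ) • P := by
          push_cast; module
        rw [this]
        exact hP1.add (hP.smul (by exact_mod_cast hc1))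
      · rw [smul_mul_assoc, trace_smul, smul_eq_mul, Complex.re_ofReal_mul, ← hp,
          div_mul_cancel₀ _ hp0.ne']
    have := hβ _ hmem
    rw [smul_mul_assoc, trace_smul, smul_eq_mul, Complex.re_ofReal_mul, div_mul_eq_mul_div,
      lt_div_iff₀ hp0] at this
    nlinarith

variable [Group G] [Fintype G] (U : G →* Matrix.unitaryGroup n ℂ)

theorem exists_test_of_test {ρ σ ξ Q : Matrix n n ℂ} (hρ : IsQuantumState ρ)
    (hσ : IsQuantumState σ) (hinv : σ = groupTwirl U σ) (hξ : ξ = groupTwirl U ρ) {ε ε' μ : ℝ}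
    (hε' : 0 < ε') (hμ : 0 < μ)
    (hβ : ∀ Q ∈ hypothesisTests ε' ξ, μ * ε' < (Q * σ).trace.re)
    (hQ : Q ∈ hypothesisTests (ε + √(2 * ε')) ρ) :
    ∃ Q' ∈ hypothesisTests ε ρ, (Q' * ξ).trace.re * μ ≤ (Q * σ).trace.re := by
  obtain ⟨hQ0, hQ1, hQε⟩ := hQ
  have hσU : ∀ g, Commute σ (U g : Matrix n n ℂ) := fun g => by
    rw [hinv]; exact groupTwirl_commute U σ g
  have hξU : ∀ g, Commute ξ (U g : Matrix n n ℂ) := fun g => by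
    rw [hξ]; exact groupTwirl_commute U ρ g
  have hξ0 : ξ.PosSemidef := hξ ▸ groupTwirl_posSemidef U hρ.posSemidef
  have hξ1 : ξ.trace = 1 := by rw [hξ, trace_groupTwirl, hρ.trace_eq_one]
  set H := (μ : ℂ) • ξ - σ with hH
  have hHh : H.IsHermitian :=
    (hξ0.smul (by exact_mod_cast hμ.le : (0 : ℂ) ≤ μ)).1.sub hσ.posSemidef.1
  have hHU : ∀ g, Commute H (U g : Matrix n n ℂ) := fun g =>
    ((hξU g).smul_left _).sub_left (hσU g)
  obtain ⟨P, hP, hP1, hPH, hPHH, hPc⟩ := hHh.exists_posPart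
  have hlt : (P * H).trace.re < μ * ε' :=
    re_trace_posPart_lt hσ.posSemidef hμ hε' hP hP1 hPH hβ
  -- The strict slack in the trace pays for adding `δ • 1`, which makes `Y` invertible; the
  -- denominator exceeds the dimension.
  set δ := (μ * ε' - (P * H).trace.re) / (Fintype.card n + 1) with hδ
  have hδ0 : 0 < δ := by have := sub_pos.mpr hlt; positivity
  have hδ1 : δ * Fintype.card n ≤ μ * ε' - (P * H).trace.re := by
    have : δ * (Fintype.card n + 1) = μ * ε' - (P * H).trace.re :=
      div_mul_cancel₀ _ (by positivity)
    linarith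
  have hδp : ((δ : ℂ) • (1 : Matrix n n ℂ)).PosDef :=
    PosDef.one.smul (by exact_mod_cast hδ0)
  set Y := P * H + (δ : ℂ) • (1 : Matrix n n ℂ) with hY
  have hYp : Y.PosDef := hδp.posSemidef_add hPH
  have hYtr : Y.trace.re ≤ μ * ε' := by
    rw [hY, trace_add, trace_smul, trace_one, Complex.add_re, smul_eq_mul, Complex.re_ofReal_mul,
      Complex.natCast_re]
    linarith
  have hYU : ∀ g, Commute Y (U g : Matrix n n ℂ) := fun g =>
    ((hPc _ (hHU g)).mul_left (hHU g)).add_left ((Commute.one_left _).smul_left _)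
  have hW : (σ + Y - (μ : ℂ) • ξ).PosSemidef := by
    have : σ + Y - (μ : ℂ) • ξ = (P * H - H) + (δ : ℂ) • 1 := by
      rw [hY, hH]; abel
    rw [this]
    exact hPHH.add hδp.posSemidef
  obtain ⟨T, hT1, hTσ, hTtr, hTc⟩ := hσ.posSemidef.exists_contraction hYp
  have hTU : ∀ g, Commute T (U g : Matrix n n ℂ) := fun g => hTc _ (hσU g) (hYU g)
  -- Pair `2 - T - Tᴴ ≥ 0` with `σ + Y - μ ξ ≥ 0`. As `Re Tr(T (σ + Y)) ≥ Tr σ`, there remains `μ (1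
  -- - Re Tr(T ξ)) ≤ Tr Y ≤ μ ε'`.
  have hover : 1 - ε' ≤ (T * ρ).trace.re := by
    have hre : (2 - T - Tᴴ).PosSemidef := by
      have : 2 - T - Tᴴ = (1 - T)ᴴ * (1 - T) + (1 - Tᴴ * T) := by
        rw [conjTranspose_sub, conjTranspose_one, ← one_add_one_eq_two]; noncomm_ring
      rw [this]
      exact (posSemidef_conjTranspose_mul_self _).add hT1
    have h := hre.re_trace_mul_nonneg hW
    have hTW : (Tᴴ * (σ + Y - (μ : ℂ) • ξ)).trace.re = (T * (σ + Y - (μ : ℂ) • ξ)).trace.re := by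
      rw [← re_trace_conjTranspose, conjTranspose_mul, conjTranspose_conjTranspose, hW.1.eq,
        trace_mul_comm]
    rw [sub_mul, sub_mul, trace_sub, trace_sub, Complex.sub_re, Complex.sub_re, hTW, two_mul,
      trace_add, Complex.add_re, mul_sub, trace_sub, trace_sub, trace_add, Complex.sub_re,
      Complex.sub_re, Complex.add_re, mul_smul_comm, trace_smul, trace_smul, smul_eq_mul,
      smul_eq_mul, Complex.re_ofReal_mul, Complex.re_ofReal_mul, hξ1, Complex.one_re] at h
    have hTξ : (T * ξ).trace = (T * ρ).trace := by rw [hξ, trace_mul_groupTwirl U ρ hTU]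
    rw [hTξ] at h
    have h3 : μ * (1 - ε') ≤ μ * (T * ρ).trace.re := by linarith
    exact le_of_mul_le_mul_left h3 hμ
  have hgentle := hρ.posSemidef.re_trace_mul_le_of_contraction hρ.trace_eq_one hT1 hQ0 hQ1 hover
  refine ⟨Tᴴ * Q * T, ⟨hQ0.conjTranspose_mul_mul_same T, ?_, by linarith⟩, ?_⟩
  · have : 1 - Tᴴ * Q * T = (1 - Tᴴ * T) + Tᴴ * (1 - Q) * T := by noncomm_ring
    rw [this]
    exact hT1.add (hQ1.conjTranspose_mul_mul_same T)
  · have h := hQ0.re_trace_mul_nonneg (hW.mul_mul_conjTranspose_same T)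
    have e2 : (Tᴴ * Q * T * ξ).trace = (Q * (T * ξ * Tᴴ)).trace := by
      rw [mul_assoc, mul_assoc, trace_mul_comm, mul_assoc, mul_assoc]
    rw [mul_sub, sub_mul, hTσ, mul_sub, trace_sub, Complex.sub_re, mul_smul_comm, smul_mul_assoc,
      mul_smul_comm, trace_smul, smul_eq_mul, Complex.re_ofReal_mul, ← e2] at h
    linarith

/-- Comparing only values strictly below each factor supplies the strict bound needed for `μ` and
avoids both infinite values and the existence of optimal tests. -/
theorem optimalTest_mul_le {ρ σ ξ : Matrix n n ℂ} (hρ : IsQuantumState ρ)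
    (hσ : IsQuantumState σ) (hinv : σ = groupTwirl U σ) (hξ : ξ = groupTwirl U ρ) {ε ε' : ℝ}
    (hε' : 0 < ε') :
    (⨅ Q ∈ hypothesisTests ε ρ, ENNReal.ofReal (Q * ξ).trace.re) * optimalTestValue ε' ξ σ ≤
      ⨅ Q ∈ hypothesisTests (ε + √(2 * ε')) ρ, ENNReal.ofReal (Q * σ).trace.re := by
  refine le_iInf₂ fun Q hQ => ENNReal.mul_le_of_forall_lt fun a ha b hb => ?_
  rcases eq_or_ne b 0 with rfl | hb0
  · simp
  have hbt : b ≠ ∞ := ne_top_of_lt hb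
  have hμ : 0 < b.toReal := ENNReal.toReal_pos hb0 hbt
  obtain ⟨Q', hQ', hle⟩ := exists_test_of_test U hρ hσ hinv hξ (μ := b.toReal) hε' hμ (by
    intro Q hQ
    have hε0 : ENNReal.ofReal ε' ≠ 0 := by simpa using hε'
    rw [optimalTestValue, mul_comm, ← div_eq_mul_inv,
      ENNReal.lt_div_iff_mul_lt (Or.inl hε0) (Or.inl ENNReal.ofReal_ne_top)] at hb
    have := hb.trans_le (iInf₂_le Q hQ)
    rw [← ENNReal.ofReal_toReal hbt, ← ENNReal.ofReal_mul hμ.le] at this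
    exact (ENNReal.ofReal_lt_ofReal_iff_of_nonneg (by positivity)).mp this) hQ
  calc a * b ≤ ENNReal.ofReal (Q' * ξ).trace.re * b := by
        gcongr; exact (ha.trans_le (iInf₂_le Q' hQ')).le
    _ = ENNReal.ofReal ((Q' * ξ).trace.re * b.toReal) := by
        rw [ENNReal.ofReal_mul' hμ.le, ENNReal.ofReal_toReal hbt]
    _ ≤ _ := ENNReal.ofReal_le_ofReal hle

theorem optimalTestValue_mul_le {ρ σ ξ : Matrix n n ℂ} (hρ : IsQuantumState ρ)
    (hσ : IsQuantumState σ) (hinv : σ = groupTwirl U σ) (hξ : ξ = groupTwirl U ρ) {ε ε' : ℝ}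
    (hε : 0 < ε) (hε' : 0 < ε') :
    optimalTestValue ε ρ ξ * optimalTestValue ε' ξ σ ≤
      ENNReal.ofReal ((ε + √(2 * ε')) / ε) * optimalTestValue (ε + √(2 * ε')) ρ σ := by
  have h := optimalTest_mul_le U hρ hσ hinv hξ (ε := ε) hε'
  have hs : 0 < ε + √(2 * ε') := by positivity
  have h1 : ENNReal.ofReal (ε + √(2 * ε')) ≠ 0 := by simpa using hs
  rw [ENNReal.ofReal_div_of_pos hε, optimalTestValue, optimalTestValue, mul_assoc, div_eq_mul_inv,
    optimalTestValue.eq_def (ε + √(2 * ε')), mul_comm (ENNReal.ofReal (ε + √(2 * ε'))), mul_assoc,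
    ENNReal.mul_inv_cancel_left h1 ENNReal.ofReal_ne_top]
  exact mul_le_mul_right h _

theorem optimalTestValue_eq_top {ε : ℝ} {ρ σ : Matrix n n ℂ} (hε : 0 < ε) :
    optimalTestValue ε ρ σ = ∞ ↔ hypothesisTests ε ρ = ∅ := by
  have h0 : (ENNReal.ofReal ε)⁻¹ ≠ ∞ := by simpa using hε
  rw [optimalTestValue, ENNReal.mul_eq_top]
  simp only [ne_eq, ENNReal.inv_eq_zero, ENNReal.ofReal_ne_top, not_false_eq_true, true_and, h0,
    false_and, or_false, iInf_eq_top, imp_false, Set.eq_empty_iff_forall_notMem]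

theorem hypothesisTests_eq_empty_iff {ε : ℝ} {ρ : Matrix n n ℂ} (hρ : ρ.PosSemidef)
    (h1 : ρ.trace = 1) : hypothesisTests ε ρ = ∅ ↔ 1 < ε := by
  rw [Set.eq_empty_iff_forall_notMem]
  refine ⟨fun h => ?_, fun h Q hQ => ?_⟩
  · by_contra! hε
    exact h 1 ⟨PosSemidef.one, by simpa using PosSemidef.zero, by simpa [h1] using hε⟩
  · have := hQ.2.1.re_trace_mul_nonneg hρ
    rw [sub_mul, one_mul, trace_sub, h1, Complex.sub_re, Complex.one_re] at this
    linarith [hQ.2.2]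

end Decomposition

/-! ### Passage to extended real logarithms -/

/-- In `EReal` the sum `⊥ + ⊤` is `⊥`, so an infinite `v₁` or `v₂` sends the right side to `⊥`; `h₁`
and `h₂` ensure that the left side is then `⊥` too. -/
theorem neg_log_div_le_of_mul_le {v v₁ v₂ : ℝ≥0∞} {r L : ℝ} (hr : 0 < r) (hL : 0 < L)
    (h : v₁ * v₂ ≤ ENNReal.ofReal r * v) (h₁ : v₁ = ∞ → v = ∞) (h₂ : v₂ = ∞ → v = ∞) :
    -(v.log / (L : EReal)) ≤
      -(v₁.log / (L : EReal)) + -(v₂.log / (L : EReal)) + ((Real.log r / L : ℝ) : EReal) := by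
  have hLE : (0 : EReal) < L := by exact_mod_cast hL
  have hLt : (L : EReal) ≠ ⊤ := EReal.coe_ne_top L
  have hbot : (⊥ : EReal) / L = ⊥ := EReal.bot_div_of_pos_ne_top hLE hLt
  have htop : (⊤ : EReal) / L = ⊤ := EReal.top_div_of_pos_ne_top hLE hLt
  by_cases hv : v = ∞
  · simp [hv, htop]
  have h₁' : v₁ ≠ ∞ := fun e => hv (h₁ e)
  have h₂' : v₂ ≠ ∞ := fun e => hv (h₂ e)
  have key : ∀ w : ℝ≥0∞, w ≠ ∞ → w ≠ 0 →
      w.log / (L : EReal) = ((Real.log w.toReal / L : ℝ) : EReal) := fun w hw hw0 => by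
    rw [ENNReal.log_pos_real hw0 hw, EReal.coe_div]
  have hne : ∀ w : ℝ≥0∞, w ≠ ∞ → -(w.log / (L : EReal)) ≠ ⊥ := fun w hw => by
    rcases eq_or_ne w 0 with rfl | hw0
    · simp [hbot]
    · rw [key w hw hw0, ← EReal.coe_neg]; exact EReal.coe_ne_bot _
  rcases eq_or_ne v₁ 0 with rfl | h10
  · rw [ENNReal.log_zero, hbot, EReal.neg_bot, EReal.top_add_of_ne_bot (hne _ h₂'),
      EReal.top_add_coe]
    exact le_top
  rcases eq_or_ne v₂ 0 with rfl | h20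
  · rw [ENNReal.log_zero, hbot, EReal.neg_bot, EReal.add_top_of_ne_bot (hne _ h₁'),
      EReal.top_add_coe]
    exact le_top
  have hv0 : v ≠ 0 := by
    rintro rfl
    simp [h10, h20] at h
  rw [key v hv hv0, key v₁ h₁' h10, key v₂ h₂' h20]
  have p : 0 < v.toReal := ENNReal.toReal_pos hv0 hv
  have p1 : 0 < v₁.toReal := ENNReal.toReal_pos h10 h₁'
  have p2 : 0 < v₂.toReal := ENNReal.toReal_pos h20 h₂'
  have hreal : v₁.toReal * v₂.toReal ≤ r * v.toReal := by
    have := ENNReal.toReal_mono (ENNReal.mul_ne_top ENNReal.ofReal_ne_top hv) h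
    rwa [ENNReal.toReal_mul, ENNReal.toReal_mul, ENNReal.toReal_ofReal hr.le] at this
  have hlog := Real.log_le_log (by positivity) hreal
  rw [Real.log_mul p1.ne' p2.ne', Real.log_mul hr.ne' p.ne'] at hlog
  norm_cast
  rw [← sub_nonneg]
  have e : -(Real.log v₁.toReal / L) + -(Real.log v₂.toReal / L) + Real.log r / L
      - -(Real.log v.toReal / L)
      = (Real.log r + Real.log v.toReal - (Real.log v₁.toReal + Real.log v₂.toReal)) / L := by
    ring
  rw [e]
  exact div_nonneg (sub_nonneg.mpr hlog) hL.le

theorem mainTheorem3 {n G : Type*} [Fintype n] [DecidableEq n] [Group G] [Fintype G]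
    (U : G →* Matrix.unitaryGroup n ℂ) (ρ σ ξ : Matrix n n ℂ)
    (hρ : IsQuantumState ρ) (hσ : IsQuantumState σ)
    (hinv : σ = groupTwirl U σ) (hξ : ξ = groupTwirl U ρ)
    (ε ε' : ℝ) (hε : 0 < ε) (hε' : 0 < ε') :
    hypothesisTestingRelEntropy (ε + √(2 * ε')) ρ σ ≤
      hypothesisTestingRelEntropy ε ρ ξ + hypothesisTestingRelEntropy ε' ξ σ +
        ((Real.logb 2 ((ε + √(2 * ε')) / ε) : ℝ) : EReal) := by
  have hs : 0 < ε + √(2 * ε') := by positivity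
  have hξ0 : ξ.PosSemidef := hξ ▸ groupTwirl_posSemidef U hρ.posSemidef
  have hξ1 : ξ.trace = 1 := by rw [hξ, trace_groupTwirl, hρ.trace_eq_one]
  refine neg_log_div_le_of_mul_le (by positivity) (Real.log_pos one_lt_two)
    (optimalTestValue_mul_le U hρ hσ hinv hξ hε hε') ?_ ?_
  · rw [optimalTestValue_eq_top hε, optimalTestValue_eq_top hs,
      hypothesisTests_eq_empty_iff hρ.posSemidef hρ.trace_eq_one,
      hypothesisTests_eq_empty_iff hρ.posSemidef hρ.trace_eq_one]
    intro h
    linarith [Real.sqrt_nonneg (2 * ε')]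
  · rw [optimalTestValue_eq_top hε', optimalTestValue_eq_top hs,
      hypothesisTests_eq_empty_iff hξ0 hξ1,
      hypothesisTests_eq_empty_iff hρ.posSemidef hρ.trace_eq_one]
    intro h
    have : 1 ≤ √(2 * ε') := Real.one_le_sqrt.mpr (by linarith)
    linarith
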